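/- Let $R=\mathbb C[x_0,\dots,x_n]=\bigoplus_t R_t$, with $R_t=0$ for $t<0$ and $r_t=\dim_{\mathbb C}R_t$. Let $I=(F_1,\dots,F_r)\subset R$ be an artinian ideal generated by $r$ forms of degree $d$, put $A=R/I$, and write $I_t=I\cap R_t$ and $A_t=R_t/I_t$. Let $i\ge 0$, $k\ge 1$ be integers, and assume that there is no syzygy of degree $i$ among the $F_j$, i.e. $\sum_j G_jF_j=0$ with all $G_j\in R_i$ implies $G_1=\dots=G_r=0$. Put $$N=r(r_i-r_{i-k})-(r_{d+i}-r_{d+i-k}),\qquad N^+=\max(0,N),\qquad N^-=\max(0,-N).$$ For a positive integer $\delta$ consider the following conditions. * $(2)_\delta$ For a general linear form $L$ there are $N^++\delta$ vectors $(G_{1l},\dots,G_{rl})\in R_i^{\oplus r}$, linearly independent modulo $L^k$ (that is, in $(R/L^kR)^{\oplus r}$; if $i<k$ this is just linear independence), and forms $G_l\in R_{d+i-k}$, such that $G_{1l}F_1+\dots+G_{rl}F_r=L^kG_l$ for $l=1,\dots,N^++\delta$. * $(3)_\delta$ The projection of the Veronese variety $v_{d+i}(\mathbb P^n)$ from $I_{d+i}$,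 i.e. the variety parametrized by $[L]\mapsto[L^{d+i}\bmod I_{d+i}]\in\mathbb P(A_{d+i})$ (lines in $A_{d+i}$), satisfies exactly $\delta$ non-trivial Laplace equations of order $s=d+i-k$: the span of the partial derivatives of order at most $s$ of this parametrization at a general point (its $s$-th osculating space) has projective dimension $$\inf\Bigl(\tbinom{n+s}{n}-\dim I_s-1,\ \dim A_{d+i}-1\Bigr)-\delta .$$ (The $\dim I_s$ relations among the derivatives given by the forms of $I_s$ are trivial and are not counted. If $i<k$ then $I_s=0$, and this is the usual definition, with expected dimension $\inf(\binom{n+s}{n}-1,\dim A_{d+i}-1)$; if $s<0$ there are no derivatives and $\binom{n+s}{n}$ is read as $0$.) * $(4)_\delta$ For every nonzero $L=\sum a_jx_j\in R_1$, the forms of degree $d+i$ on the dual projective space that are apolar to $I_{d+i}$ (the space $(I_{d+i}^\perp)^*$: all $f$ of degree $d+i$ with $F(\partial)f=0$ for every $F\in I_{d+i}$) and have multiplicity at least $d+i-k+1$ at the point $L^\vee=[a_0:\dots:a_n]$ form a vector space of dimension at least $N^-+\delta$. Then the following are equivalent: 1. $I$ fails the SLP at range $k$ in degree $d+i-k$,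 i.e. for every linear form $L$ the multiplication map $\times L^k:A_{d+i-k}\to A_{d+i}$ is neither injective nor surjective; 2. $(2)_\delta$ holds for some $\delta\ge1$; 3. $(3)_\delta$ holds for some $\delta\ge1$; 4. $(4)_\delta$ holds for some $\delta\ge1$. Moreover, for each fixed $\delta\ge 1$, the conditions $(2)_\delta$, $(4)_\delta$ and "$(3)_{\delta'}$ holds for some $\delta'\ge\delta$" are equivalent. If $i<k$, condition $(3)_\delta$ coincides, for every integer $\delta\ge0$, with the usual definition of satisfying $\delta$ Laplace equations of order $d+i-k$. -/

import Mathlib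

open MvPolynomial

noncomputable section

/-- The space `R_t` of forms of degree `t` in `R = ℂ[x_0, …, x_n]`, for an integer `t`;
it is zero for `t < 0`. -/
def forms (n : ℕ) (t : ℤ) : Submodule ℂ (MvPolynomial (Fin (n + 1)) ℂ) :=
  match t with
  | Int.ofNat m => homogeneousSubmodule (Fin (n + 1)) ℂ m
  | Int.negSucc _ => ⊥

/-- `r_t = dim R_t`. -/
def dimForms (n : ℕ) (t : ℤ) : ℕ := Module.finrank ℂ (forms n t)

/-- `N(r,i,k,d) = r (r_i - r_{i-k}) - (r_{d+i} - r_{d+i-k})`. -/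
def numN (n r i k d : ℕ) : ℤ :=
  (r : ℤ) * ((dimForms n i : ℤ) - (dimForms n ((i : ℤ) - k) : ℤ))
    - ((dimForms n ((d : ℤ) + i) : ℤ) - (dimForms n ((d : ℤ) + i - k) : ℤ))

/-- `N⁺ = sup (0, N)`. -/
def numNPlus (n r i k d : ℕ) : ℕ := (numN n r i k d).toNat

/-- `N⁻ = sup (0, -N)`. -/
def numNMinus (n r i k d : ℕ) : ℕ := (-numN n r i k d).toNat

/-- The linear form `a_0 x_0 + ⋯ + a_n x_n`. -/
def linForm {n : ℕ} (a : Fin (n + 1) → ℂ) : MvPolynomial (Fin (n + 1)) ℂ :=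
  ∑ j, C (a j) * X j

/-- `P` holds at a general point of `ℂ^m`: on a non-empty Zariski open subset, which may
be taken to be the complement of a hypersurface. -/
def ForGeneral {m : ℕ} (P : (Fin m → ℂ) → Prop) : Prop :=
  ∃ Q : MvPolynomial (Fin m) ℂ, Q ≠ 0 ∧ ∀ a, eval a Q ≠ 0 → P a

/-- `I_t = I ∩ R_t`. -/
def idealPiece {n : ℕ} (I : Ideal (MvPolynomial (Fin (n + 1)) ℂ)) (t : ℤ) :
    Submodule ℂ (MvPolynomial (Fin (n + 1)) ℂ) :=
  I.restrictScalars ℂ ⊓ forms n t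

/-- The graded piece `A_t` of `A = R / I`: the image of `R_t` in `A`. -/
def quotPiece {n : ℕ} (I : Ideal (MvPolynomial (Fin (n + 1)) ℂ)) (t : ℤ) :
    Submodule ℂ (MvPolynomial (Fin (n + 1)) ℂ ⧸ I) :=
  (forms n t).map (Ideal.Quotient.mkₐ ℂ I).toLinearMap

/-- Multiplication by `L ^ k` from `A_e` to `A_{e+k}` has maximal rank. -/
def HasMaximalRank {n : ℕ} (I : Ideal (MvPolynomial (Fin (n + 1)) ℂ))
    (L : MvPolynomial (Fin (n + 1)) ℂ) (k : ℕ) (e : ℤ) : Prop :=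
  Set.InjOn (fun x => Ideal.Quotient.mk I L ^ k * x) (quotPiece I e) ∨
    Set.SurjOn (fun x => Ideal.Quotient.mk I L ^ k * x) (quotPiece I e) (quotPiece I (e + k))

/-- `I` fails the strong Lefschetz property at range `k` in degree `e`. -/
def FailsSLPAt {n : ℕ} (I : Ideal (MvPolynomial (Fin (n + 1)) ℂ)) (k : ℕ) (e : ℤ) : Prop :=
  ∀ L ∈ forms n 1, ¬ HasMaximalRank I L k e

/-- There is no syzygy of degree `i` among the `F_j`. -/
def NoSyzygy {n r : ℕ} (F : Fin r → MvPolynomial (Fin (n + 1)) ℂ) (i : ℕ) : Prop :=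
  ∀ G : Fin r → MvPolynomial (Fin (n + 1)) ℂ,
    (∀ j, G j ∈ forms n i) → ∑ j, G j * F j = 0 → G = 0

/-- For a general linear form `L` there are `c` vectors `(G_{1l}, …, G_{rl})` of forms of
degree `i`, linearly independent modulo `L ^ k`, and `c` forms `H_l` of degree `d + i - k`, with
`G_{1l} F_1 + ⋯ + G_{rl} F_r = L ^ k H_l`. -/
def HasRelations {n r : ℕ} (F : Fin r → MvPolynomial (Fin (n + 1)) ℂ) (d i k c : ℕ) : Prop :=
  ForGeneral fun a : Fin (n + 1) → ℂ =>
    ∃ (G : Fin c → Fin r → MvPolynomial (Fin (n + 1)) ℂ)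
      (H : Fin c → MvPolynomial (Fin (n + 1)) ℂ),
      (∀ l j, G l j ∈ forms n i) ∧
      (∀ l, H l ∈ forms n ((d : ℤ) + i - k)) ∧
      LinearIndependent ℂ
        (fun l j => Ideal.Quotient.mk (Ideal.span {linForm a ^ k}) (G l j)) ∧
      ∀ l, ∑ j, G l j * F j = linForm a ^ k * H l

/-- The iterated partial derivative `∂^α`. -/
def partialDeriv {A : Type*} [CommRing A] {m : ℕ} (α : Fin m →₀ ℕ) :
    Module.End A (MvPolynomial (Fin m) A) :=
  ((List.finRange m).map fun j =>
    ((pderiv j).toLinearMap : Module.End A (MvPolynomial (Fin m) A)) ^ α j).prod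

/-- For a polynomial map `φ` from `ℂ^n` to the vector space `A`, parametrizing a variety in the
projective space of lines of `A`: the linear span of the partial derivatives of order at most `s`
of `φ` at `y`, the cone over the `s`-th osculating space at the point `[φ y]`. -/
def osculatingSpace {A : Type*} [CommRing A] [Algebra ℂ A] {n : ℕ}
    (φ : MvPolynomial (Fin n) A) (s : ℤ) (y : Fin n → ℂ) : Submodule ℂ A :=
  Submodule.span ℂ
    {v | ∃ α : Fin n →₀ ℕ, ((α.degree : ℕ) : ℤ) ≤ s ∧
      v = eval (fun j => algebraMap ℂ A (y j)) (partialDeriv α φ)}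

/-- The number of partial derivatives of order at most `s` in `n` variables: `(n + s choose n)`
for `s ≥ 0`, and `0` for `s < 0`. -/
def numDerivs (n : ℕ) (s : ℤ) : ℕ :=
  match s with
  | Int.ofNat m => (n + m).choose n
  | Int.negSucc _ => 0

/-- The variety parametrized by `φ` in the projective space of lines of `V` satisfies `δ` Laplace
equations of order `s`, where `τ` relations between the derivatives are discounted as trivial: its
`s`-th osculating space at a general point has projective dimension
`inf ((n + s choose n) - τ - 1, dim V - 1) - δ`. -/
def SatisfiesLaplaceModulo {A : Type*} [CommRing A] [Algebra ℂ A] {n : ℕ}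
    (V : Submodule ℂ A) (φ : MvPolynomial (Fin n) A) (s : ℤ) (τ δ : ℕ) : Prop :=
  ForGeneral fun y : Fin n → ℂ =>
    (Module.finrank ℂ (osculatingSpace φ s y) : ℤ) - 1 =
      min ((numDerivs n s : ℤ) - τ - 1) ((Module.finrank ℂ V : ℤ) - 1) - δ

/-- The variety parametrized by `φ` in the projective space of lines of `V` satisfies `δ` Laplace
equations of order `s`: its `s`-th osculating space at a general point has projective dimension
`inf ((n + s choose n) - 1, dim V - 1) - δ`. -/
def SatisfiesLaplace {A : Type*} [CommRing A] [Algebra ℂ A] {n : ℕ}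
    (V : Submodule ℂ A) (φ : MvPolynomial (Fin n) A) (s : ℤ) (δ : ℕ) : Prop :=
  SatisfiesLaplaceModulo V φ s 0 δ

/-- The Veronese variety `[L] ↦ [L ^ t]` in the chart `L = x_0 + y_1 x_1 + ⋯ + y_n x_n`, as a
polynomial in the parameters `y` with coefficients in `R`. -/
def veroneseParam (n t : ℕ) : MvPolynomial (Fin n) (MvPolynomial (Fin (n + 1)) ℂ) :=
  (C (X 0) + ∑ j : Fin n, C (X j.succ) * X j) ^ t

/-- The projection of the Veronese variety from `I_t`: `[L] ↦ [L ^ t mod I]`, with values in the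
projective space of lines of `R_t / I_t = A_t`. -/
def projVeroneseParam {n : ℕ} (I : Ideal (MvPolynomial (Fin (n + 1)) ℂ)) (t : ℕ) :
    MvPolynomial (Fin n) (MvPolynomial (Fin (n + 1)) ℂ ⧸ I) :=
  MvPolynomial.map (Ideal.Quotient.mk I) (veroneseParam n t)

/-- `F(∂) f`, the apolarity action. -/
def diffOp {n : ℕ} (F f : MvPolynomial (Fin (n + 1)) ℂ) : MvPolynomial (Fin (n + 1)) ℂ :=
  ∑ α ∈ F.support, coeff α F • partialDeriv α f

/-- The forms of degree `t` on the dual projective space that are apolar to `I_t`: this is the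
space `(I_t^⊥)^*`. -/
def apolarForms {n : ℕ} (I : Ideal (MvPolynomial (Fin (n + 1)) ℂ)) (t : ℤ) :
    Submodule ℂ (MvPolynomial (Fin (n + 1)) ℂ) where
  carrier := {f | f ∈ forms n t ∧ ∀ F ∈ idealPiece I t, diffOp F f = 0}
  zero_mem' := ⟨Submodule.zero_mem _, fun F _ => by simp [diffOp]⟩
  add_mem' := fun hf hg => ⟨Submodule.add_mem _ hf.1 hg.1, fun F hF => by
    have h1 := hf.2 F hF
    have h2 := hg.2 F hF
    simp only [diffOp, map_add, smul_add, Finset.sum_add_distrib] at h1 h2 ⊢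
    rw [h1, h2, add_zero]⟩
  smul_mem' := fun c f hf => ⟨Submodule.smul_mem _ c hf.1, fun F hF => by
    have h1 := hf.2 F hF
    simp only [diffOp, map_smul, smul_comm _ c, ← Finset.smul_sum] at h1 ⊢
    rw [h1, smul_zero]⟩

/-- The polynomials having multiplicity at least `μ` at the point `a`: all partial derivatives of
order less than `μ` vanish there. -/
def multiplicityAtLeast {n : ℕ} (μ : ℤ) (a : Fin (n + 1) → ℂ) :
    Submodule ℂ (MvPolynomial (Fin (n + 1)) ℂ) where
  carrier := {f | ∀ α : Fin (n + 1) →₀ ℕ, ((α.degree : ℕ) : ℤ) < μ →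
    eval a (partialDeriv α f) = 0}
  zero_mem' := fun α _ => by simp
  add_mem' := fun hf hg α hα => by simp [hf α hα, hg α hα]
  smul_mem' := fun c f hf α hα => by simp [hf α hα]

/-- For every nonzero linear form `L = a_0 x_0 + ⋯ + a_n x_n`, the forms in `(I_{d+i}^⊥)^*` with
multiplicity at least `d + i - k + 1` at the point `L^∨ = [a]` of the dual projective space form a
vector space of dimension at least `c`. -/
def HasSingularForms {n : ℕ} (I : Ideal (MvPolynomial (Fin (n + 1)) ℂ)) (d i k c : ℕ) : Prop :=
  ∀ a : Fin (n + 1) → ℂ, a ≠ 0 →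
    c ≤ Module.finrank ℂ
      ↥(apolarForms I ((d : ℤ) + i) ⊓ multiplicityAtLeast ((d : ℤ) + i - k + 1) a)

/-- The projection of the Veronese variety `v_{d+i}(ℙ^n)` from `I_{d+i}` satisfies `δ` Laplace
equations of order `d + i - k`. The relations given by the forms `G` in `I_{d+i-k}` are trivial and
are not counted: the derivative of `L ^ (d+i)` along `G` is a multiple of `L ^ k G`, which the
projection kills. They exist only if `i ≥ k`. -/
def ProjectionSatisfiesLaplace {n : ℕ} (I : Ideal (MvPolynomial (Fin (n + 1)) ℂ))
    (d i k δ : ℕ) : Prop :=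
  SatisfiesLaplaceModulo (quotPiece I ((d : ℤ) + i)) (projVeroneseParam I (d + i))
    ((d : ℤ) + i - k) (Module.finrank ℂ (idealPiece I ((d : ℤ) + i - k))) δ

end

/-! ### Forms -/

/-! Put `s = d + i - k`, `a = dim A_s`, `b = dim A_{d+i}`, and let `ρ` be the rank of `×L^k : A_s →
A_{d+i}` for general `L`. Rank is lower semicontinuous, so `ρ` is also the maximum over all `L`
(`exists_general_powMulRank`). Every condition is a statement about `ρ`, `a` and `b`.

Absence of syzygies in degree `i` passes down to degree `i - k`, so `dim I_{d+i}` and `dim I_s` are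
`r r_i` and `r r_{i-k}`. Hence `N = a - b` (`numN_eq`) and `min(a, b) = a - N⁺ = b - N⁻`.

Failure of the SLP means `ρ < min(a, b)`. Solutions of `∑ G_j F_j ∈ L^k R_s`, taken modulo `L^k`,
form a space of dimension `a - ρ`, that of the kernel of `×L^k` (`finrank_map_reductionMap`). Under
the apolarity pairing, the forms apolar to `I_{d+i}` with multiplicity at least `s + 1` at `L^∨` are
the orthogonal of `I_{d+i} + L^k R_s`, of dimension `b - ρ`
(`finrank_apolarForms_inf_multiplicityAtLeast`). The `s`-th osculating space at `[L^{d+i}]` is the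
image of `L^k R_s` in `A_{d+i}`, of dimension `ρ` (`osculatingSpace_projVeroneseParam`), while the
expected dimension is `min(a, b)`.

So relations and singular forms with parameter `δ` both say `ρ + δ ≤ min(a, b)`, and exactly `δ`
Laplace equations says `ρ + δ = min(a, b)`. -/

lemma forms_natCast (n m : ℕ) : forms n (m : ℤ) = homogeneousSubmodule (Fin (n + 1)) ℂ m := rfl

lemma mem_forms_natCast {n m : ℕ} {P : MvPolynomial (Fin (n + 1)) ℂ} :
    P ∈ forms n (m : ℤ) ↔ P.IsHomogeneous m := Iff.rfl

lemma forms_of_neg {n : ℕ} {t : ℤ} (ht : t < 0) : forms n t = ⊥ := by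
  obtain ⟨m, rfl⟩ := Int.eq_negSucc_of_lt_zero ht
  rfl

instance finiteDimensional_forms (n : ℕ) (t : ℤ) : FiniteDimensional ℂ (forms n t) := by
  rcases lt_or_ge t 0 with ht | ht
  · rw [forms_of_neg ht]
    infer_instance
  · lift t to ℕ using ht
    exact Module.Finite.of_fg (homogeneousSubmodule_fg (Fin (n + 1)) ℂ t)

lemma homogeneousSubmodule_eq_span_monomial (n m : ℕ) :
    homogeneousSubmodule (Fin (n + 1)) ℂ m =
      Submodule.span ℂ (Set.range fun β : {β : Fin (n + 1) →₀ ℕ // β.degree = m} =>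
        monomial (β : Fin (n + 1) →₀ ℕ) (1 : ℂ)) := by
  refine le_antisymm (fun P hP => ?_) (Submodule.span_le.2 ?_)
  · rw [P.as_sum]
    refine Submodule.sum_mem _ fun β hβ => ?_
    rw [← mul_one (coeff β P), ← smul_eq_mul, ← smul_monomial]
    exact Submodule.smul_mem _ _ (Submodule.subset_span
      ⟨⟨β, (IsHomogeneous.degree_eq_sum_deg_support hP hβ).symm⟩, rfl⟩)
  · rintro _ ⟨β, rfl⟩
    exact isHomogeneous_monomial _ β.2

/-- Monomials of degree `m` in `n + 1` variables are multisets of size `m`, as many as the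
derivatives of order at most `m` in `n` variables. This ties the expected osculating dimension to
`dim R_s`. -/
lemma finrank_forms (n : ℕ) (t : ℤ) : Module.finrank ℂ (forms n t) = numDerivs n t := by
  rcases t with m | m
  · change Module.finrank ℂ (homogeneousSubmodule (Fin (n + 1)) ℂ m) = (n + m).choose n
    have e : Sym (Fin (n + 1)) m ≃ {β : Fin (n + 1) →₀ ℕ // β.degree = m} :=
      (Sym.equivNatSum (Fin (n + 1)) m).trans (Equiv.subtypeEquivRight fun β => by
        simp [Finsupp.sum, Finsupp.degree_apply])
    let _ : Fintype {β : Fin (n + 1) →₀ ℕ // β.degree = m} := Fintype.ofEquiv _ e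
    rw [homogeneousSubmodule_eq_span_monomial, finrank_span_eq_card, ← Fintype.card_congr e,
      Sym.card_sym_eq_choose, Fintype.card_fin, Nat.add_right_comm, Nat.add_sub_cancel,
      Nat.choose_symm_add]
    · have := (basisMonomials (Fin (n + 1)) ℂ).linearIndependent
      rw [coe_basisMonomials] at this
      exact this.comp _ Subtype.val_injective
  · change Module.finrank ℂ (⊥ : Submodule ℂ (MvPolynomial (Fin (n + 1)) ℂ)) = 0
    simp

lemma isHomogeneous_linForm {n : ℕ} (a : Fin (n + 1) → ℂ) : (linForm a).IsHomogeneous 1 :=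
  IsHomogeneous.sum _ _ _ fun _ _ => isHomogeneous_C_mul_X _ _

lemma isHomogeneous_linForm_pow {n : ℕ} (a : Fin (n + 1) → ℂ) (k : ℕ) :
    (linForm a ^ k).IsHomogeneous k := by
  simpa using (isHomogeneous_linForm a).pow k

lemma coeff_single_linForm {n : ℕ} (a : Fin (n + 1) → ℂ) (j : Fin (n + 1)) :
    coeff (Finsupp.single j 1) (linForm a) = a j := by
  classical
  simp [linForm, coeff_sum, coeff_C_mul, coeff_X, Finsupp.single_left_inj]

lemma linForm_ne_zero {n : ℕ} {a : Fin (n + 1) → ℂ} (ha : a ≠ 0) : linForm a ≠ 0 := by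
  contrapose! ha
  ext j
  simpa [ha] using (coeff_single_linForm a j).symm

lemma exists_eq_linForm {n : ℕ} {L : MvPolynomial (Fin (n + 1)) ℂ} (hL : L ∈ forms n 1) :
    ∃ a, L = linForm a := by
  change L ∈ homogeneousSubmodule (Fin (n + 1)) ℂ 1 at hL
  rw [homogeneousSubmodule_one_eq_span_X, Submodule.mem_span_range_iff_exists_fun] at hL
  obtain ⟨a, rfl⟩ := hL
  exact ⟨a, by simp [linForm, smul_eq_C_mul]⟩

lemma linForm_mem_forms {n : ℕ} (a : Fin (n + 1) → ℂ) : linForm a ∈ forms n 1 :=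
  isHomogeneous_linForm a

lemma linForm_smul {n : ℕ} (c : ℂ) (a : Fin (n + 1) → ℂ) : linForm (c • a) = c • linForm a := by
  simp [linForm, Finset.smul_sum, smul_eq_C_mul, mul_assoc]

lemma mul_mem_forms {n m : ℕ} {t : ℤ} {P Q : MvPolynomial (Fin (n + 1)) ℂ}
    (hP : P.IsHomogeneous m) (hQ : Q ∈ forms n t) : P * Q ∈ forms n (t + m) := by
  rcases lt_or_ge t 0 with ht | ht
  · rw [forms_of_neg ht, Submodule.mem_bot] at hQ
    simp [hQ]
  · lift t to ℕ using ht
    rw [add_comm (t : ℤ)]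
    exact_mod_cast hP.mul hQ

lemma homogeneousComponent_mul_of_right {n d : ℕ} (m : ℕ) (P : MvPolynomial (Fin (n + 1)) ℂ)
    {Q : MvPolynomial (Fin (n + 1)) ℂ} (hQ : Q.IsHomogeneous d) :
    homogeneousComponent m (P * Q) =
      if d ≤ m then homogeneousComponent (m - d) P * Q else 0 := by
  let _ : GradedAlgebra (homogeneousSubmodule (Fin (n + 1)) ℂ) := gradedAlgebra
  have := DirectSum.coe_decompose_mul_of_right_mem
    (homogeneousSubmodule (Fin (n + 1)) ℂ) (a := P) (b := Q) m hQ
  have h : ∀ (P : MvPolynomial (Fin (n + 1)) ℂ) (m : ℕ),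
      (DirectSum.decompose (homogeneousSubmodule (Fin (n + 1)) ℂ) P m :
        MvPolynomial (Fin (n + 1)) ℂ) = homogeneousComponent m P :=
    fun P m => decomposition.decompose'_apply P m
  simpa only [h] using this

/-- The component in `R_t` of a polynomial. -/
noncomputable def formComponent (n : ℕ) (t : ℤ) :
    MvPolynomial (Fin (n + 1)) ℂ →ₗ[ℂ] MvPolynomial (Fin (n + 1)) ℂ :=
  match t with
  | Int.ofNat m => homogeneousComponent m
  | Int.negSucc _ => 0

lemma formComponent_mem (n : ℕ) (t : ℤ) (P : MvPolynomial (Fin (n + 1)) ℂ) :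
    formComponent n t P ∈ forms n t := by
  rcases t with m | m
  · exact homogeneousComponent_isHomogeneous m P
  · exact Submodule.zero_mem _

lemma formComponent_eq_self {n : ℕ} {t : ℤ} {P : MvPolynomial (Fin (n + 1)) ℂ}
    (hP : P ∈ forms n t) : formComponent n t P = P := by
  rcases t with m | m
  · exact homogeneousComponent_eq_self hP
  · exact ((Submodule.mem_bot ℂ).1 hP).symm

/-- Integer degrees let an identity be cut down to one degree without asking whether `t - d` is
negative. -/
lemma formComponent_mul_of_right {n d : ℕ} (t : ℤ) (P : MvPolynomial (Fin (n + 1)) ℂ)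
    {Q : MvPolynomial (Fin (n + 1)) ℂ} (hQ : Q.IsHomogeneous d) :
    formComponent n t (P * Q) = formComponent n (t - d) P * Q := by
  rcases lt_or_ge t 0 with ht | ht
  · obtain ⟨m, rfl⟩ := Int.eq_negSucc_of_lt_zero ht
    obtain ⟨m', hm'⟩ := Int.eq_negSucc_of_lt_zero (show Int.negSucc m - d < 0 by omega)
    rw [hm']
    simp [formComponent]
  · lift t to ℕ using ht
    change homogeneousComponent t (P * Q) = _
    rw [homogeneousComponent_mul_of_right t P hQ]
    split_ifs with h
    · rw [← Nat.cast_sub h]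
      rfl
    · obtain ⟨m', hm'⟩ := Int.eq_negSucc_of_lt_zero (show (t : ℤ) - d < 0 by omega)
      rw [hm']
      simp [formComponent]

/-! ### General points -/

lemma exists_of_forGeneral {m : ℕ} {P Q : (Fin m → ℂ) → Prop} (hP : ForGeneral P)
    (hQ : ForGeneral Q) : ∃ a, P a ∧ Q a := by
  obtain ⟨p, hp, hp'⟩ := hP
  obtain ⟨q, hq, hq'⟩ := hQ
  obtain ⟨a, ha⟩ : ∃ a, eval a (p * q) ≠ 0 := by
    by_contra! h
    exact mul_ne_zero hp hq (MvPolynomial.funext fun a => by simpa using h a)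
  rw [map_mul] at ha
  exact ⟨a, hp' a (left_ne_zero_of_mul ha), hq' a (right_ne_zero_of_mul ha)⟩

lemma ForGeneral.mono {m : ℕ} {P Q : (Fin m → ℂ) → Prop} (hP : ForGeneral P)
    (h : ∀ a, P a → Q a) : ForGeneral Q :=
  let ⟨p, hp, hp'⟩ := hP
  ⟨p, hp, fun a ha => h a (hp' a ha)⟩

lemma ForGeneral.and {m : ℕ} {P Q : (Fin m → ℂ) → Prop} (hP : ForGeneral P)
    (hQ : ForGeneral Q) : ForGeneral fun a => P a ∧ Q a :=
  let ⟨p, hp, hp'⟩ := hP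
  let ⟨q, hq, hq'⟩ := hQ
  ⟨p * q, mul_ne_zero hp hq, fun a ha => by
    rw [map_mul] at ha
    exact ⟨hp' a (left_ne_zero_of_mul ha), hq' a (right_ne_zero_of_mul ha)⟩⟩

lemma forGeneral_apply_zero_ne_zero (n : ℕ) :
    ForGeneral fun a : Fin (n + 1) → ℂ => a 0 ≠ 0 :=
  ⟨X 0, X_ne_zero 0, fun a ha => by simpa using ha⟩

lemma forGeneral_ne_zero (n : ℕ) : ForGeneral fun a : Fin (n + 1) → ℂ => a ≠ 0 :=
  (forGeneral_apply_zero_ne_zero n).mono fun a ha h => ha (by simp [h])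

/-- The rank of a family of linear maps depending polynomially on parameters is lower
semicontinuous. -/
lemma exists_finrank_range_le {m : ℕ} {V W : Type*} [AddCommGroup V] [Module ℂ V]
    [FiniteDimensional ℂ V] [AddCommGroup W] [Module ℂ W]
    (T : (Fin m → ℂ) → V →ₗ[ℂ] W)
    (hT : ∀ (f : Module.Dual ℂ W) (v : V), ∃ p : MvPolynomial (Fin m) ℂ,
      ∀ a, eval a p = f (T a v)) (a₀ : Fin m → ℂ) :
    ∃ q : MvPolynomial (Fin m) ℂ, eval a₀ q ≠ 0 ∧ ∀ a, eval a q ≠ 0 →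
      Module.finrank ℂ (LinearMap.range (T a₀)) ≤ Module.finrank ℂ (LinearMap.range (T a)) := by
  set ρ := Module.finrank ℂ (LinearMap.range (T a₀)) with hρ
  let b := Module.finBasis ℂ (LinearMap.range (T a₀))
  choose v hv using fun i => (b i).2
  -- `g` extends the coordinates on the range of `T a₀` to all of `W`. The matrix of the `g (T a (v
  -- i))` is polynomial in `a` and is the identity at `a₀`; where its determinant is nonzero, the
  -- vectors `T a (v i)` stay independent.
  obtain ⟨g, hg⟩ := LinearMap.exists_extend (b.equivFun.toLinearMap)
  choose p hp using fun i j => hT ((LinearMap.proj j).comp g) (v i)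
  have hM : ∀ a, eval a (Matrix.of p).det = (Matrix.of fun i => g (T a (v i))).det := fun a => by
    rw [RingHom.map_det]
    congr 1
    ext i j
    simpa using hp i j a
  refine ⟨(Matrix.of p).det, ?_, fun a ha => ?_⟩
  · rw [hM]
    have : (Matrix.of fun i => g (T a₀ (v i))) = 1 := by
      ext i j
      have h1 : g (b i : W) = b.equivFun (b i) := LinearMap.congr_fun hg (b i)
      simp only [Matrix.of_apply, hv, h1]
      simp [Matrix.one_apply]
    rw [this, Matrix.det_one]
    exact one_ne_zero
  · rw [hM] at ha
    have h1 : LinearIndependent ℂ fun i => g (T a (v i)) :=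
      Matrix.linearIndependent_rows_of_det_ne_zero ha
    have h2 : LinearIndependent ℂ fun i => T a (v i) := h1.of_comp g
    have h3 : LinearIndependent ℂ fun i => (T a).rangeRestrict (v i) :=
      LinearIndependent.of_comp (LinearMap.range (T a)).subtype h2
    simpa using h3.fintype_card_le_finrank

/-! ### Dimensions of the graded pieces -/

lemma finrank_map_add_finrank_inf_ker {K V W : Type*} [DivisionRing K] [AddCommGroup V] [Module K V]
    [AddCommGroup W] [Module K W] (f : V →ₗ[K] W) (S : Submodule K V) [FiniteDimensional K S] :
    Module.finrank K (S.map f) + Module.finrank K ↥(S ⊓ LinearMap.ker f) = Module.finrank K S := by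
  rw [← LinearMap.finrank_range_add_finrank_ker (f.domRestrict S), LinearMap.range_domRestrict,
    LinearMap.ker_domRestrict, ← Submodule.map_comap_subtype,
    (Submodule.equivMapOfInjective S.subtype S.injective_subtype _).finrank_eq]

lemma ker_mkₐ_toLinearMap {n : ℕ} (I : Ideal (MvPolynomial (Fin (n + 1)) ℂ)) :
    LinearMap.ker (Ideal.Quotient.mkₐ ℂ I).toLinearMap = I.restrictScalars ℂ := by
  ext P
  simp [Ideal.Quotient.eq_zero_iff_mem]

instance finiteDimensional_idealPiece {n : ℕ} (I : Ideal (MvPolynomial (Fin (n + 1)) ℂ)) (t : ℤ) :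
    FiniteDimensional ℂ (idealPiece I t) :=
  Submodule.finiteDimensional_of_le (inf_le_right : _ ≤ forms n t)

instance finiteDimensional_quotPiece {n : ℕ} (I : Ideal (MvPolynomial (Fin (n + 1)) ℂ)) (t : ℤ) :
    FiniteDimensional ℂ (quotPiece I t) := by
  unfold quotPiece
  infer_instance

lemma finrank_quotPiece_add_finrank_idealPiece {n : ℕ} (I : Ideal (MvPolynomial (Fin (n + 1)) ℂ))
    (t : ℤ) : Module.finrank ℂ (quotPiece I t) + Module.finrank ℂ (idealPiece I t) =
      Module.finrank ℂ (forms n t) := by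
  have := finrank_map_add_finrank_inf_ker (Ideal.Quotient.mkₐ ℂ I).toLinearMap (forms n t)
  rwa [ker_mkₐ_toLinearMap, inf_comm] at this

/-- The map `(G_1, …, G_r) ↦ G_1 F_1 + ⋯ + G_r F_r` on vectors of forms of degree `m`. -/
noncomputable def combinationMap {n r : ℕ} (F : Fin r → MvPolynomial (Fin (n + 1)) ℂ) (m : ℤ) :
    (Fin r → forms n m) →ₗ[ℂ] MvPolynomial (Fin (n + 1)) ℂ :=
  ∑ j, (LinearMap.mulRight ℂ (F j)).comp ((forms n m).subtype.comp (LinearMap.proj j))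

lemma combinationMap_apply {n r : ℕ} (F : Fin r → MvPolynomial (Fin (n + 1)) ℂ) (m : ℤ)
    (G : Fin r → forms n m) :
    combinationMap F m G = ∑ j, (G j : MvPolynomial (Fin (n + 1)) ℂ) * F j := by
  simp [combinationMap]

lemma range_combinationMap {n r d : ℕ} {F : Fin r → MvPolynomial (Fin (n + 1)) ℂ}
    (hF : ∀ j, (F j).IsHomogeneous d) (m : ℤ) :
    LinearMap.range (combinationMap F m) = idealPiece (Ideal.span (Set.range F)) (d + m) := by
  ext P
  constructor
  · rintro ⟨G, rfl⟩
    rw [combinationMap_apply]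
    refine ⟨Ideal.sum_mem _ fun j _ => Ideal.mul_mem_left _ _ (Ideal.subset_span ⟨j, rfl⟩),
      Submodule.sum_mem _ fun j _ => ?_⟩
    rw [mul_comm, add_comm (d : ℤ)]
    exact mul_mem_forms (hF j) (G j).2
  · rintro ⟨hP, hP'⟩
    obtain ⟨G, rfl⟩ := Ideal.mem_span_range_iff_exists_fun.1 hP
    -- The coefficients `G j` need not be homogeneous. Since the sum has degree `d + m`, only their
    -- components of degree `m` contribute.
    refine ⟨fun j => ⟨formComponent n m (G j), formComponent_mem n m _⟩, ?_⟩
    rw [combinationMap_apply, ← formComponent_eq_self hP', map_sum]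
    exact Finset.sum_congr rfl fun j _ => by
      rw [formComponent_mul_of_right _ _ (hF j), add_sub_cancel_left]

lemma injective_combinationMap {n r i : ℕ} {F : Fin r → MvPolynomial (Fin (n + 1)) ℂ}
    (hsyz : NoSyzygy F i) : Function.Injective (combinationMap F i) := by
  rw [← LinearMap.ker_eq_bot, LinearMap.ker_eq_bot']
  intro G hG
  rw [combinationMap_apply] at hG
  have := hsyz (fun j => G j) (fun j => (G j).2) hG
  ext1 j
  exact Subtype.ext (congrFun this j)

/-- A syzygy of degree `i - k` multiplied by `x_0^k` is a syzygy of degree `i`. -/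
lemma injective_combinationMap_sub {n r i : ℕ} {F : Fin r → MvPolynomial (Fin (n + 1)) ℂ}
    (hsyz : NoSyzygy F i) (k : ℕ) : Function.Injective (combinationMap F (i - k)) := by
  rw [← LinearMap.ker_eq_bot, LinearMap.ker_eq_bot']
  intro G hG
  rw [combinationMap_apply] at hG
  have := hsyz (fun j => X 0 ^ k * (G j : MvPolynomial (Fin (n + 1)) ℂ))
    (fun j => by
      simpa using mul_mem_forms (isHomogeneous_X_pow (R := ℂ) (0 : Fin (n + 1)) k) (G j).2)
    (by simp_rw [mul_assoc]; rw [← Finset.mul_sum, hG, mul_zero])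
  ext1 j
  exact Subtype.ext ((mul_eq_zero_iff_left (pow_ne_zero k (X_ne_zero 0))).1 (congrFun this j))

lemma finrank_idealPiece_of_injective {n r d : ℕ} {F : Fin r → MvPolynomial (Fin (n + 1)) ℂ}
    (hF : ∀ j, (F j).IsHomogeneous d) {m : ℤ} (h : Function.Injective (combinationMap F m)) :
    Module.finrank ℂ (idealPiece (Ideal.span (Set.range F)) (d + m)) = r * dimForms n m := by
  rw [← range_combinationMap hF, LinearMap.finrank_range_of_inj h, Module.finrank_pi_fintype]
  simp [dimForms]

lemma numN_eq {n r d i k : ℕ} {F : Fin r → MvPolynomial (Fin (n + 1)) ℂ}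
    (hF : ∀ j, (F j).IsHomogeneous d) (hsyz : NoSyzygy F i) :
    numN n r i k d = Module.finrank ℂ (quotPiece (Ideal.span (Set.range F)) ((d : ℤ) + i - k)) -
      Module.finrank ℂ (quotPiece (Ideal.span (Set.range F)) ((d : ℤ) + i)) := by
  have h1 := finrank_idealPiece_of_injective hF (injective_combinationMap hsyz)
  have h2 := finrank_idealPiece_of_injective hF (injective_combinationMap_sub hsyz k)
  rw [← add_sub_assoc] at h2
  have h3 := finrank_quotPiece_add_finrank_idealPiece (Ideal.span (Set.range F)) ((d : ℤ) + i)
  have h4 := finrank_quotPiece_add_finrank_idealPiece (Ideal.span (Set.range F)) ((d : ℤ) + i - k)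
  rw [numN]
  unfold dimForms at *
  zify at h1 h2 h3 h4
  linear_combination h3 - h4 - h1 + h2

/-! ### Multiplication by the power of a linear form -/

/-- The subspace `L ^ k R_s` of `R`. -/
noncomputable def powMulForms {n : ℕ} (k : ℕ) (s : ℤ) (a : Fin (n + 1) → ℂ) :
    Submodule ℂ (MvPolynomial (Fin (n + 1)) ℂ) :=
  (forms n s).map (LinearMap.mulLeft ℂ (linForm a ^ k))

/-- The map `R_s → R / I`, `G ↦ L ^ k G`. -/
noncomputable def powMulMap {n : ℕ} (I : Ideal (MvPolynomial (Fin (n + 1)) ℂ)) (k : ℕ) (s : ℤ)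
    (a : Fin (n + 1) → ℂ) : forms n s →ₗ[ℂ] MvPolynomial (Fin (n + 1)) ℂ ⧸ I :=
  ((Ideal.Quotient.mkₐ ℂ I).toLinearMap.comp (LinearMap.mulLeft ℂ (linForm a ^ k))).domRestrict
    (forms n s)

/-- The rank of `×L ^ k : A_s → A_{s+k}`. -/
noncomputable def powMulRank {n : ℕ} (I : Ideal (MvPolynomial (Fin (n + 1)) ℂ)) (k : ℕ) (s : ℤ)
    (a : Fin (n + 1) → ℂ) : ℕ :=
  Module.finrank ℂ (LinearMap.range (powMulMap I k s a))

instance finiteDimensional_powMulForms {n : ℕ} (k : ℕ) (s : ℤ) (a : Fin (n + 1) → ℂ) :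
    FiniteDimensional ℂ (powMulForms k s a) := by
  unfold powMulForms
  infer_instance

lemma mem_powMulForms {n k : ℕ} {s : ℤ} {a : Fin (n + 1) → ℂ}
    {P : MvPolynomial (Fin (n + 1)) ℂ} :
    P ∈ powMulForms k s a ↔ ∃ G ∈ forms n s, linForm a ^ k * G = P := by
  simp [powMulForms]

lemma powMulForms_le {n : ℕ} (k : ℕ) (s : ℤ) (a : Fin (n + 1) → ℂ) :
    powMulForms k s a ≤ forms n (s + k) := by
  rintro _ ⟨G, hG, rfl⟩
  exact mul_mem_forms (isHomogeneous_linForm_pow a k) hG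

lemma mem_forms_of_mul_mem {n k : ℕ} {s : ℤ} {a : Fin (n + 1) → ℂ} (ha : a ≠ 0)
    {P : MvPolynomial (Fin (n + 1)) ℂ} (hP : linForm a ^ k * P ∈ forms n s) :
    P ∈ forms n (s - k) := by
  have h := formComponent_eq_self hP
  rw [mul_comm, formComponent_mul_of_right _ _ (isHomogeneous_linForm_pow a k)] at h
  rw [← mul_right_cancel₀ (pow_ne_zero k (linForm_ne_zero ha)) h]
  exact formComponent_mem _ _ _

lemma range_powMulMap {n : ℕ} (I : Ideal (MvPolynomial (Fin (n + 1)) ℂ)) (k : ℕ) (s : ℤ)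
    (a : Fin (n + 1) → ℂ) : LinearMap.range (powMulMap I k s a) =
      (powMulForms k s a).map (Ideal.Quotient.mkₐ ℂ I).toLinearMap := by
  rw [powMulMap, LinearMap.range_domRestrict, Submodule.map_comp, powMulForms]

lemma range_powMulMap_le {n : ℕ} (I : Ideal (MvPolynomial (Fin (n + 1)) ℂ)) (k : ℕ) (s : ℤ)
    (a : Fin (n + 1) → ℂ) : LinearMap.range (powMulMap I k s a) ≤ quotPiece I (s + k) := by
  rw [range_powMulMap]
  exact Submodule.map_mono (powMulForms_le k s a)

lemma range_powMulMap_eq_map_quotPiece {n : ℕ} (I : Ideal (MvPolynomial (Fin (n + 1)) ℂ)) (k : ℕ)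
    (s : ℤ) (a : Fin (n + 1) → ℂ) : LinearMap.range (powMulMap I k s a) =
      (quotPiece I s).map (LinearMap.mulLeft ℂ (Ideal.Quotient.mk I (linForm a) ^ k)) := by
  rw [powMulMap, LinearMap.range_domRestrict, quotPiece, ← Submodule.map_comp]
  congr 1

lemma powMulRank_add_finrank_inf {n : ℕ} (I : Ideal (MvPolynomial (Fin (n + 1)) ℂ)) (k : ℕ)
    (s : ℤ) (a : Fin (n + 1) → ℂ) :
    powMulRank I k s a + Module.finrank ℂ ↥(powMulForms k s a ⊓ idealPiece I (s + k)) =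
      Module.finrank ℂ (powMulForms k s a) := by
  have := finrank_map_add_finrank_inf_ker (Ideal.Quotient.mkₐ ℂ I).toLinearMap (powMulForms k s a)
  rw [ker_mkₐ_toLinearMap, ← range_powMulMap] at this
  rw [← this, powMulRank, idealPiece, inf_comm (I.restrictScalars ℂ), ← inf_assoc,
    inf_eq_left.2 (powMulForms_le k s a)]

lemma finrank_powMulForms {n : ℕ} (k : ℕ) (s : ℤ) {a : Fin (n + 1) → ℂ} (ha : a ≠ 0) :
    Module.finrank ℂ (powMulForms k s a) = Module.finrank ℂ (forms n s) :=
  ((forms n s).equivMapOfInjective _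
    (mul_right_injective₀ (pow_ne_zero k (linForm_ne_zero ha)))).finrank_eq.symm

lemma powMulRank_le_finrank_source {n : ℕ} (I : Ideal (MvPolynomial (Fin (n + 1)) ℂ)) (k : ℕ)
    (s : ℤ) (a : Fin (n + 1) → ℂ) : powMulRank I k s a ≤ Module.finrank ℂ (quotPiece I s) := by
  rw [powMulRank, range_powMulMap_eq_map_quotPiece]
  exact Submodule.finrank_map_le _ _

lemma powMulRank_le_finrank_target {n : ℕ} (I : Ideal (MvPolynomial (Fin (n + 1)) ℂ)) (k : ℕ)
    (s : ℤ) (a : Fin (n + 1) → ℂ) :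
    powMulRank I k s a ≤ Module.finrank ℂ (quotPiece I (s + k)) :=
  Submodule.finrank_mono (range_powMulMap_le I k s a)

lemma hasMaximalRank_iff {n : ℕ} (I : Ideal (MvPolynomial (Fin (n + 1)) ℂ)) (k : ℕ)
    (s : ℤ) (a : Fin (n + 1) → ℂ) : HasMaximalRank I (linForm a) k s ↔
      powMulRank I k s a = Module.finrank ℂ (quotPiece I s) ∨
        powMulRank I k s a = Module.finrank ℂ (quotPiece I (s + k)) := by
  refine or_congr ?_ ?_
  · have := finrank_map_add_finrank_inf_ker
      (LinearMap.mulLeft ℂ (Ideal.Quotient.mk I (linForm a) ^ k)) (quotPiece I s)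
    rw [← range_powMulMap_eq_map_quotPiece] at this
    change powMulRank I k s a + _ = _ at this
    rw [← this, eq_comm, Nat.add_eq_left, Submodule.finrank_eq_zero, ← disjoint_iff,
      LinearMap.disjoint_ker_iff_injOn]
    rfl
  · have hle := range_powMulMap_le I k s a
    trans quotPiece I (s + k) ≤ LinearMap.range (powMulMap I k s a)
    · rw [range_powMulMap_eq_map_quotPiece]
      rfl
    · exact ⟨fun h => congrArg (fun S : Submodule ℂ _ => Module.finrank ℂ S) (le_antisymm hle h),
        fun h => (Submodule.eq_of_le_of_finrank_eq hle h).ge⟩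

lemma powMulRank_smul {n : ℕ} (I : Ideal (MvPolynomial (Fin (n + 1)) ℂ)) (k : ℕ) (s : ℤ)
    (a : Fin (n + 1) → ℂ) {c : ℂ} (hc : c ≠ 0) :
    powMulRank I k s (c • a) = powMulRank I k s a := by
  have : powMulMap I k s (c • a) = c ^ k • powMulMap I k s a := by
    refine LinearMap.ext fun P => ?_
    change Ideal.Quotient.mkₐ ℂ I (linForm (c • a) ^ k * P) =
      c ^ k • Ideal.Quotient.mkₐ ℂ I (linForm a ^ k * P)
    rw [linForm_smul, smul_pow, smul_mul_assoc, map_smul]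
  rw [powMulRank, this, LinearMap.range_smul _ _ (pow_ne_zero k hc), powMulRank]

/-- Expanding one factor `L` at a time shows polynomial dependence on the coefficients of `L`, as
`exists_finrank_range_le` requires. -/
lemma exists_eval_eq_apply_linForm_pow_mul {n : ℕ}
    (f : Module.Dual ℂ (MvPolynomial (Fin (n + 1)) ℂ)) (k : ℕ)
    (G : MvPolynomial (Fin (n + 1)) ℂ) :
    ∃ p : MvPolynomial (Fin (n + 1)) ℂ, ∀ a, eval a p = f (linForm a ^ k * G) := by
  induction k generalizing G with
  | zero => exact ⟨C (f G), fun a => by simp⟩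
  | succ k ih =>
    choose p hp using fun j => ih (X j * G)
    refine ⟨∑ j, X j * p j, fun a => ?_⟩
    have : linForm a ^ (k + 1) * G = ∑ j, a j • (linForm a ^ k * (X j * G)) := by
      rw [pow_succ, mul_assoc, linForm.eq_1 a, Finset.sum_mul, Finset.mul_sum]
      exact Finset.sum_congr rfl fun j _ => by rw [smul_eq_C_mul]; ring
    simp [this, hp]

/-- The rank of `×L ^ k : A_s → A_{s+k}` for a general linear form `L`. -/
lemma exists_general_powMulRank {n : ℕ} (I : Ideal (MvPolynomial (Fin (n + 1)) ℂ)) (k : ℕ)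
    (s : ℤ) : ∃ ρ : ℕ, (∀ a, powMulRank I k s a ≤ ρ) ∧
      (ForGeneral fun a : Fin (n + 1) → ℂ => powMulRank I k s a = ρ) ∧
      ForGeneral fun y : Fin n → ℂ => powMulRank I k s (Fin.cons 1 y) = ρ := by
  have hsemi := exists_finrank_range_le (powMulMap I k s) fun f G =>
    exists_eval_eq_apply_linForm_pow_mul (f.comp (Ideal.Quotient.mkₐ ℂ I).toLinearMap) k G
  have hbdd : BddAbove (Set.range (powMulRank I k s)) :=
    ⟨_, by rintro _ ⟨a, rfl⟩; exact powMulRank_le_finrank_source I k s a⟩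
  obtain ⟨a₀, ha₀⟩ := Nat.sSup_mem (Set.range_nonempty _) hbdd
  set ρ := sSup (Set.range (powMulRank I k s))
  have hle : ∀ a, powMulRank I k s a ≤ ρ := fun a => le_csSup hbdd ⟨a, rfl⟩
  have hgen : ForGeneral fun a : Fin (n + 1) → ℂ => powMulRank I k s a = ρ := by
    obtain ⟨q, hq, hq'⟩ := hsemi a₀
    exact ⟨q, by rintro rfl; simp at hq, fun a ha => le_antisymm (hle a) (ha₀ ▸ hq' a ha)⟩
  refine ⟨ρ, hle, hgen, ?_⟩
  -- The chart `a 0 = 1` is a proper closed subset, so genericity in `ℂ^{n+1}` does not restrict to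
  -- it directly. Rescaling a general point, which keeps the rank, gives a chart point of rank `ρ`,
  -- from which semicontinuity starts again.
  obtain ⟨a, ha, ha'⟩ := exists_of_forGeneral hgen (forGeneral_apply_zero_ne_zero n)
  have hcons : a = a 0 • (Fin.cons 1 fun j : Fin n => (a 0)⁻¹ * a j.succ : Fin (n + 1) → ℂ) := by
    ext j
    refine Fin.cases ?_ (fun j => ?_) j <;> simp [ha']
  rw [hcons, powMulRank_smul _ _ _ _ ha'] at ha
  obtain ⟨q, hq, hq'⟩ := hsemi (Fin.cons 1 fun j : Fin n => (a 0)⁻¹ * a j.succ)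
  -- Setting `x_0 = 1` in `q` gives the polynomial for the chart; it is nonzero because `q` does not
  -- vanish at the chosen chart point.
  have heval : ∀ y : Fin n → ℂ,
      eval y (aeval (Fin.cons 1 X : Fin (n + 1) → MvPolynomial (Fin n) ℂ) q) =
        eval (Fin.cons 1 y) q := fun y => by
    rw [← coe_aeval_eq_eval, ← coe_aeval_eq_eval]
    change (aeval y) _ = (aeval _) q
    rw [← AlgHom.comp_apply]
    congr 1
    ext j
    refine Fin.cases ?_ (fun j => ?_) j <;> simp
  refine ⟨aeval (Fin.cons 1 X : Fin (n + 1) → MvPolynomial (Fin n) ℂ) q, ?_, fun y hy => ?_⟩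
  · intro h
    rw [← heval, h, map_zero] at hq
    exact hq rfl
  · rw [heval] at hy
    exact le_antisymm (hle _) (ha ▸ hq' _ hy)

/-! ### Relations modulo the power of a linear form -/

/-- The reduction modulo `L ^ k` of vectors of forms of degree `m`. -/
noncomputable def reductionMap {n : ℕ} (r k : ℕ) (m : ℤ) (a : Fin (n + 1) → ℂ) :
    (Fin r → forms n m) →ₗ[ℂ]
      (Fin r → MvPolynomial (Fin (n + 1)) ℂ ⧸ Ideal.span {linForm a ^ k}) :=
  LinearMap.pi fun j => (Ideal.Quotient.mkₐ ℂ (Ideal.span {linForm a ^ k})).toLinearMap.comp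
    ((forms n m).subtype.comp (LinearMap.proj j))

lemma reductionMap_apply {n r k : ℕ} {m : ℤ} {a : Fin (n + 1) → ℂ} (G : Fin r → forms n m)
    (j : Fin r) : reductionMap r k m a G j =
      Ideal.Quotient.mk (Ideal.span {linForm a ^ k}) (G j : MvPolynomial (Fin (n + 1)) ℂ) := rfl

/-- Multiplication of vectors of forms by `L ^ k`. -/
noncomputable def vectorPowMulMap {n : ℕ} (r k : ℕ) (m : ℤ) (a : Fin (n + 1) → ℂ) :
    (Fin r → forms n (m - k)) →ₗ[ℂ] (Fin r → forms n m) :=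
  LinearMap.pi fun j => ((LinearMap.mulLeft ℂ (linForm a ^ k)).restrict fun P hP => by
    simpa using mul_mem_forms (isHomogeneous_linForm_pow a k) hP).comp (LinearMap.proj j)

lemma coe_vectorPowMulMap_apply {n r k : ℕ} {m : ℤ} {a : Fin (n + 1) → ℂ}
    (G : Fin r → forms n (m - k)) (j : Fin r) :
    (vectorPowMulMap r k m a G j : MvPolynomial (Fin (n + 1)) ℂ) = linForm a ^ k * G j := rfl

lemma ker_reductionMap {n : ℕ} (r k : ℕ) (m : ℤ) {a : Fin (n + 1) → ℂ} (ha : a ≠ 0) :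
    LinearMap.ker (reductionMap r k m a) = LinearMap.range (vectorPowMulMap r k m a) := by
  ext G
  rw [LinearMap.mem_ker, LinearMap.mem_range]
  constructor
  · intro hG
    have h : ∀ j, ∃ P, (G j : MvPolynomial (Fin (n + 1)) ℂ) = linForm a ^ k * P := fun j => by
      have := congrFun hG j
      rwa [reductionMap_apply, Pi.zero_apply, Ideal.Quotient.eq_zero_iff_mem,
        Ideal.mem_span_singleton] at this
    choose P hP using h
    refine ⟨fun j => ⟨P j, mem_forms_of_mul_mem ha (hP j ▸ (G j).2)⟩, ?_⟩
    ext1 j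
    exact Subtype.ext (hP j).symm
  · rintro ⟨G, rfl⟩
    ext1 j
    rw [reductionMap_apply, Pi.zero_apply, Ideal.Quotient.eq_zero_iff_mem,
      Ideal.mem_span_singleton, coe_vectorPowMulMap_apply]
    exact dvd_mul_right _ _

lemma injective_vectorPowMulMap {n : ℕ} (r k : ℕ) (m : ℤ) {a : Fin (n + 1) → ℂ} (ha : a ≠ 0) :
    Function.Injective (vectorPowMulMap r k m a) := fun G G' h => by
  ext1 j
  have := congrArg Subtype.val (congrFun h j)
  rw [coe_vectorPowMulMap_apply, coe_vectorPowMulMap_apply] at this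
  exact Subtype.ext (mul_left_cancel₀ (pow_ne_zero k (linForm_ne_zero ha)) this)

/-- Let `W` be the space of vectors whose combination lies in `L^k R_s`. By injectivity `W ≅ L^k R_s
∩ I_{d+i}`, of dimension `dim R_s - rank`. The kernel of reduction modulo `L^k` is `L^k R_{i-k}^r`;
it lies in `W` and has dimension `r r_{i-k} = dim I_s`. The difference is `dim A_s - rank`. -/
lemma finrank_map_reductionMap {n r d i : ℕ} {F : Fin r → MvPolynomial (Fin (n + 1)) ℂ}
    (hF : ∀ j, (F j).IsHomogeneous d) (hsyz : NoSyzygy F i) (k : ℕ) {a : Fin (n + 1) → ℂ}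
    (ha : a ≠ 0) :
    Module.finrank ℂ (((powMulForms k ((d : ℤ) + i - k) a).comap (combinationMap F i)).map
      (reductionMap r k i a)) + powMulRank (Ideal.span (Set.range F)) k ((d : ℤ) + i - k) a =
      Module.finrank ℂ (quotPiece (Ideal.span (Set.range F)) ((d : ℤ) + i - k)) := by
  set W := (powMulForms k ((d : ℤ) + i - k) a).comap (combinationMap F i) with hW
  have h1 := finrank_map_add_finrank_inf_ker (reductionMap r k i a) W
  have hker : LinearMap.ker (reductionMap r k i a) ≤ W := by
    rw [ker_reductionMap r k i ha]
    rintro _ ⟨G, rfl⟩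
    rw [hW, Submodule.mem_comap, combinationMap_apply, mem_powMulForms]
    refine ⟨combinationMap F _ G, ?_, ?_⟩
    · have : combinationMap F _ G ∈ LinearMap.range (combinationMap F _) := ⟨G, rfl⟩
      rw [range_combinationMap hF, ← add_sub_assoc] at this
      exact this.2
    · rw [combinationMap_apply, Finset.mul_sum]
      exact Finset.sum_congr rfl fun j _ => by rw [coe_vectorPowMulMap_apply, mul_assoc]
  rw [inf_eq_right.2 hker, ker_reductionMap r k i ha,
    LinearMap.finrank_range_of_inj (injective_vectorPowMulMap r k i ha),
    Module.finrank_pi_fintype] at h1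
  have h2 : Module.finrank ℂ W = Module.finrank ℂ
      ↥(powMulForms k ((d : ℤ) + i - k) a ⊓ idealPiece (Ideal.span (Set.range F)) (d + i)) := by
    rw [(W.equivMapOfInjective _ (injective_combinationMap hsyz)).finrank_eq, hW,
      Submodule.map_comap_eq, range_combinationMap hF, inf_comm]
  have h3 := powMulRank_add_finrank_inf (Ideal.span (Set.range F)) k ((d : ℤ) + i - k) a
  rw [finrank_powMulForms k _ ha, sub_add_cancel] at h3
  have h4 := finrank_idealPiece_of_injective hF (injective_combinationMap_sub hsyz k)
  rw [← add_sub_assoc] at h4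
  have h5 := finrank_quotPiece_add_finrank_idealPiece (Ideal.span (Set.range F)) ((d : ℤ) + i - k)
  simp only [Finset.sum_const, Finset.card_univ, Fintype.card_fin, smul_eq_mul] at h1
  rw [dimForms] at h4
  omega

lemma exists_relations_iff {n r d i : ℕ} {F : Fin r → MvPolynomial (Fin (n + 1)) ℂ}
    (hF : ∀ j, (F j).IsHomogeneous d) (hsyz : NoSyzygy F i) (k c : ℕ) {a : Fin (n + 1) → ℂ}
    (ha : a ≠ 0) :
    (∃ (G : Fin c → Fin r → MvPolynomial (Fin (n + 1)) ℂ)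
      (H : Fin c → MvPolynomial (Fin (n + 1)) ℂ),
      (∀ l j, G l j ∈ forms n i) ∧
      (∀ l, H l ∈ forms n ((d : ℤ) + i - k)) ∧
      LinearIndependent ℂ
        (fun l j => Ideal.Quotient.mk (Ideal.span {linForm a ^ k}) (G l j)) ∧
      ∀ l, ∑ j, G l j * F j = linForm a ^ k * H l) ↔
    c + powMulRank (Ideal.span (Set.range F)) k ((d : ℤ) + i - k) a ≤
      Module.finrank ℂ (quotPiece (Ideal.span (Set.range F)) ((d : ℤ) + i - k)) := by
  rw [← finrank_map_reductionMap hF hsyz k ha, add_le_add_iff_right]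
  set S := ((powMulForms k ((d : ℤ) + i - k) a).comap (combinationMap F i)).map
      (reductionMap r k i a) with hS
  constructor
  · rintro ⟨G, H, hG, hH, hli, h⟩
    have hmem : ∀ l, (fun j => Ideal.Quotient.mk (Ideal.span {linForm a ^ k}) (G l j)) ∈ S :=
      fun l => ⟨fun j => ⟨G l j, hG l j⟩, by
        rw [SetLike.mem_coe, Submodule.mem_comap, combinationMap_apply, mem_powMulForms]
        exact ⟨H l, hH l, (h l).symm⟩, rfl⟩
    have hli' : LinearIndependent ℂ fun l => (⟨_, hmem l⟩ : S) :=
      LinearIndependent.of_comp S.subtype hli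
    simpa using hli'.fintype_card_le_finrank
  · intro hc
    obtain ⟨v, hv⟩ := exists_linearIndependent_of_le_finrank hc
    choose G hG hGv using fun l => (v l).2
    choose H hH h using fun l => mem_powMulForms.1 (hG l)
    refine ⟨fun l j => G l j, H, fun l j => (G l j).2, hH, ?_, fun l => ?_⟩
    · have := hv.map' S.subtype S.ker_subtype
      convert! this with l j
      exact congrFun (hGv l) j
    · rw [h, combinationMap_apply]

/-! ### Apolarity -/

/-- The apolarity pairing `∑_α α! F_α f_α`. -/
noncomputable def apolarPairing (n : ℕ) :
    MvPolynomial (Fin (n + 1)) ℂ →ₗ[ℂ] MvPolynomial (Fin (n + 1)) ℂ →ₗ[ℂ] ℂ :=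
  (basisMonomials (Fin (n + 1)) ℂ).constr ℂ fun α =>
    ((∏ j, (α j).factorial : ℕ) : ℂ) • lcoeff ℂ α

lemma apolarPairing_monomial_left {n : ℕ} (α : Fin (n + 1) →₀ ℕ)
    (f : MvPolynomial (Fin (n + 1)) ℂ) :
    apolarPairing n (monomial α 1) f = ((∏ j, (α j).factorial : ℕ) : ℂ) * coeff α f := by
  have := (basisMonomials (Fin (n + 1)) ℂ).constr_basis ℂ
    (fun α => ((∏ j, (α j).factorial : ℕ) : ℂ) • lcoeff (σ := Fin (n + 1)) ℂ α) α
  rw [coe_basisMonomials] at this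
  rw [apolarPairing, this]
  simp

lemma apolarPairing_monomial_right {n : ℕ} (α : Fin (n + 1) →₀ ℕ)
    (F : MvPolynomial (Fin (n + 1)) ℂ) :
    apolarPairing n F (monomial α 1) = ((∏ j, (α j).factorial : ℕ) : ℂ) * coeff α F := by
  classical
  induction F using MvPolynomial.induction_on' with
  | add p q hp hq => simp [hp, hq, mul_add]
  | monomial β c =>
    rw [← mul_one c, ← smul_eq_mul, ← smul_monomial, map_smul, LinearMap.smul_apply,
      apolarPairing_monomial_left, coeff_smul, coeff_monomial, coeff_monomial]
    rcases eq_or_ne α β with rfl | h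
    · simp [mul_comm]
    · simp [h, h.symm]

/-- The weights `α!` make multiplication by `x_j` adjoint to `∂_j`: the factor `α_j + 1` gained by
the factorial is the one produced by differentiation. -/
lemma apolarPairing_X_mul {n : ℕ} (j : Fin (n + 1)) (F f : MvPolynomial (Fin (n + 1)) ℂ) :
    apolarPairing n (X j * F) f = apolarPairing n F (pderiv j f) := by
  classical
  induction F using MvPolynomial.induction_on' with
  | add p q hp hq => simp [hp, hq, mul_add]
  | monomial α c =>
    rw [← mul_one c, ← smul_eq_mul c, ← smul_monomial, mul_smul_comm, map_smul, map_smul,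
      LinearMap.smul_apply, LinearMap.smul_apply, X, monomial_mul, one_mul,
      add_comm (Finsupp.single j 1),
      apolarPairing_monomial_left, apolarPairing_monomial_left, coeff_pderiv]
    have : (∏ l, ((α + Finsupp.single j 1 : Fin (n + 1) →₀ ℕ) l).factorial) =
        (α j + 1) * ∏ l, (α l).factorial := by
      rw [← Finset.mul_prod_erase _ _ (Finset.mem_univ j),
        ← Finset.mul_prod_erase _ (fun l => (α l).factorial) (Finset.mem_univ j), ← mul_assoc]
      congr 1
      · simp [Nat.factorial_succ]
      · refine Finset.prod_congr rfl fun l hl => ?_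
        simp [(Finset.ne_of_mem_erase hl).symm]
    rw [this]
    push_cast
    ring_nf

lemma apolarPairing_X_pow_mul {n : ℕ} (j : Fin (n + 1)) (m : ℕ)
    (F f : MvPolynomial (Fin (n + 1)) ℂ) :
    apolarPairing n (X j ^ m * F) f =
      apolarPairing n F ((((pderiv j).toLinearMap :
        Module.End ℂ (MvPolynomial (Fin (n + 1)) ℂ)) ^ m) f) := by
  induction m generalizing f with
  | zero => simp
  | succ m ih =>
    rw [pow_succ', mul_assoc, apolarPairing_X_mul, ih, pow_succ, Module.End.mul_apply]
    rfl

lemma monomial_one_eq_prod_finRange {A : Type*} [CommRing A] {m : ℕ} (α : Fin m →₀ ℕ) :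
    (monomial α 1 : MvPolynomial (Fin m) A) =
      ((List.finRange m).map fun j => X j ^ α j).prod := by
  rw [← Fin.prod_univ_def, monomial_eq, C_1, one_mul, Finsupp.prod_fintype _ _ (by simp)]

lemma degree_eq_sum_finRange {m : ℕ} (α : Fin m →₀ ℕ) :
    α.degree = ((List.finRange m).map α).sum := by
  rw [← Fin.sum_univ_def, Finsupp.degree_eq_sum]

lemma apolarPairing_monomial_mul {n : ℕ} (α : Fin (n + 1) →₀ ℕ)
    (F f : MvPolynomial (Fin (n + 1)) ℂ) :
    apolarPairing n (monomial α 1 * F) f = apolarPairing n F (partialDeriv α f) := by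
  rw [monomial_one_eq_prod_finRange, partialDeriv]
  -- Both sides are ordered products over the same list, so the identity is proved for an arbitrary
  -- list.
  induction List.finRange (n + 1) generalizing F with
  | nil => simp
  | cons j l ih =>
    rw [List.map_cons, List.prod_cons, mul_assoc, mul_left_comm, ih, apolarPairing_X_pow_mul,
      List.map_cons, List.prod_cons, Module.End.mul_apply]

lemma isHomogeneous_partialDeriv {n t : ℕ} (α : Fin (n + 1) →₀ ℕ)
    {f : MvPolynomial (Fin (n + 1)) ℂ} (hf : f.IsHomogeneous t) :
    (partialDeriv α f).IsHomogeneous (t - α.degree) := by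
  rw [degree_eq_sum_finRange, partialDeriv]
  induction List.finRange (n + 1) with
  | nil => simpa using hf
  | cons j l ih =>
    rw [List.map_cons, List.prod_cons, Module.End.mul_apply, List.map_cons, List.sum_cons,
      add_comm (α j), ← Nat.sub_sub]
    generalize (List.prod _ : Module.End ℂ (MvPolynomial (Fin (n + 1)) ℂ)) f = g at ih
    generalize t - (l.map α).sum = u at ih ⊢
    induction α j with
    | zero => simpa using ih
    | succ m ih' =>
      rw [pow_succ', Module.End.mul_apply, ← Nat.sub_sub]
      exact ih'.pderiv

/-- Moving one factor `L` across the pairing differentiates `g` along `a`; Euler's identity then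
supplies the factor `m + 1`. -/
lemma apolarPairing_linForm_pow {n m : ℕ} (a : Fin (n + 1) → ℂ)
    {g : MvPolynomial (Fin (n + 1)) ℂ} (hg : g.IsHomogeneous m) :
    apolarPairing n (linForm a ^ m) g = m.factorial * eval a g := by
  induction m generalizing g with
  | zero =>
    rw [← totalDegree_zero_iff_isHomogeneous, totalDegree_eq_zero_iff_eq_C] at hg
    rw [hg, pow_zero, ← C_1, ← monomial_zero', apolarPairing_monomial_left]
    simp
  | succ m ih =>
    have hE := congrArg (eval a) hg.sum_X_mul_pderiv
    rw [pow_succ', linForm.eq_1 a, Finset.sum_mul, ← linForm.eq_1 a, map_sum,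
      LinearMap.sum_apply]
    have : ∀ j, apolarPairing n (C (a j) * X j * linForm a ^ m) g =
        m.factorial * (a j * eval a (pderiv j g)) := fun j => by
      rw [mul_assoc, ← smul_eq_C_mul, map_smul, LinearMap.smul_apply, apolarPairing_X_mul,
        ih (by simpa using hg.pderiv (i := j)), smul_eq_mul]
      ring
    simp only [map_sum, map_mul, eval_X, nsmul_eq_mul, map_natCast] at hE
    simp only [this, ← Finset.mul_sum, hE, Nat.factorial_succ]
    push_cast
    ring

lemma diffOp_eq_C_apolarPairing {n t : ℕ} {F f : MvPolynomial (Fin (n + 1)) ℂ}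
    (hF : F.IsHomogeneous t) (hf : f.IsHomogeneous t) :
    diffOp F f = C (apolarPairing n F f) := by
  rw [diffOp]
  conv_rhs => rw [F.as_sum]
  rw [map_sum, LinearMap.sum_apply, map_sum]
  refine Finset.sum_congr rfl fun α hα => ?_
  have h := isHomogeneous_partialDeriv α hf
  rw [hF.degree_eq_sum_deg_support hα, ← Finsupp.degree_apply, Nat.sub_self] at h
  -- `∂^α f` has degree `0`, so its constant value is read off at the origin, with exponent `0`.
  have h' := apolarPairing_linForm_pow (0 : Fin (n + 1) → ℂ) h
  rw [← totalDegree_zero_iff_isHomogeneous, totalDegree_eq_zero_iff_eq_C] at h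
  rw [pow_zero, ← apolarPairing_monomial_mul, mul_one, Nat.factorial_zero, Nat.cast_one,
    one_mul, h, eval_C] at h'
  rw [h, ← mul_one (coeff α F), ← smul_eq_mul (coeff α F), ← smul_monomial, map_smul,
    LinearMap.smul_apply, h', smul_eq_C_mul, smul_eq_mul, smul_eq_mul, mul_one, C_mul]

lemma mem_apolarForms_iff {n t : ℕ} {I : Ideal (MvPolynomial (Fin (n + 1)) ℂ)}
    {f : MvPolynomial (Fin (n + 1)) ℂ} : f ∈ apolarForms I t ↔
      f ∈ forms n t ∧ ∀ F ∈ idealPiece I t, apolarPairing n F f = 0 := by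
  refine and_congr_right fun hf => forall₂_congr fun F hF => ?_
  rw [diffOp_eq_C_apolarPairing (mem_forms_natCast.1 hF.2) hf, map_eq_zero_iff _ (C_injective _ _)]

/-- Pairing `f` with `L^{t-|α|} x^α` gives `∂^α f(a)` up to a nonzero factorial. For `|α| ≤ s` these
products lie in `L^k R_s`, and those with `|α| = s` already span it. -/
lemma mem_multiplicityAtLeast_iff {n k t : ℕ} {s : ℤ} (hs : s + k = t) (a : Fin (n + 1) → ℂ)
    {f : MvPolynomial (Fin (n + 1)) ℂ} (hf : f ∈ forms n t) :
    f ∈ multiplicityAtLeast (s + 1) a ↔ ∀ P ∈ powMulForms k s a, apolarPairing n P f = 0 := by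
  rw [mem_forms_natCast] at hf
  constructor
  · rintro h _ ⟨G, hG, rfl⟩
    rcases lt_or_ge s 0 with hs0 | hs0
    · rw [forms_of_neg hs0, SetLike.mem_coe, Submodule.mem_bot] at hG
      simp [hG]
    lift s to ℕ using hs0
    rw [forms_natCast, homogeneousSubmodule_eq_span_monomial, SetLike.mem_coe] at hG
    rw [LinearMap.mulLeft_apply]
    induction hG using Submodule.span_induction with
    | zero => simp
    | add p q _ _ hp hq => rw [mul_add, map_add, LinearMap.add_apply, hp, hq, add_zero]
    | smul c p _ hp => rw [mul_smul_comm, map_smul, LinearMap.smul_apply, hp, smul_zero]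
    | mem p hp =>
      obtain ⟨⟨β, hβ⟩, rfl⟩ := hp
      have hβf := isHomogeneous_partialDeriv β hf
      rw [hβ, show t - s = k by omega] at hβf
      rw [mul_comm, apolarPairing_monomial_mul, apolarPairing_linForm_pow a hβf,
        h β (by simp only [hβ]; omega), mul_zero]
  · intro h α hα
    lift s to ℕ using (by omega)
    have hαf := isHomogeneous_partialDeriv α hf
    have h1 := apolarPairing_linForm_pow a hαf
    rw [← apolarPairing_monomial_mul, h, eq_comm, mul_eq_zero] at h1
    · exact h1.resolve_left (by exact_mod_cast Nat.factorial_ne_zero _)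
    · refine mem_powMulForms.2 ⟨linForm a ^ (s - α.degree) * monomial α 1, ?_, ?_⟩
      · have := (isHomogeneous_linForm_pow a (s - α.degree)).mul
          (isHomogeneous_monomial (1 : ℂ) (rfl : α.degree = α.degree))
        rwa [Nat.sub_add_cancel (by omega)] at this
      · rw [← mul_assoc, ← pow_add, mul_comm, show k + (s - α.degree) = t - α.degree by omega]

/-- On `R_t` the pairing is diagonal in the monomials with nonzero entries `α!`, hence
nondegenerate. -/
lemma finrank_apolarPairing_orthogonal {n t : ℕ} {W S : Submodule ℂ (MvPolynomial (Fin (n + 1)) ℂ)}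
    (hW : W ≤ forms n t)
    (hS : ∀ f, f ∈ S ↔ f ∈ forms n t ∧ ∀ F ∈ W, apolarPairing n F f = 0) :
    Module.finrank ℂ S + Module.finrank ℂ W = Module.finrank ℂ (forms n t) := by
  let B : LinearMap.BilinForm ℂ (forms n t) :=
    (apolarPairing n).domRestrict₁₂ (forms n t) (forms n t)
  have hB : ∀ f g : forms n t, B f g = apolarPairing n f g := fun f g => rfl
  have hfac : ∀ α : Fin (n + 1) →₀ ℕ, ((∏ j, (α j).factorial : ℕ) : ℂ) ≠ 0 := fun α => by
    exact_mod_cast Finset.prod_ne_zero_iff.2 fun j _ => Nat.factorial_ne_zero _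
  have hmon : ∀ α : Fin (n + 1) →₀ ℕ, α.degree = t → monomial α (1 : ℂ) ∈ forms n t :=
    fun α hα => isHomogeneous_monomial _ hα
  have hnd : B.Nondegenerate := by
    constructor
    · intro F hF
      ext α
      by_cases hα : α.degree = t
      · have := hF ⟨_, hmon α hα⟩
        rw [hB, apolarPairing_monomial_right] at this
        exact (mul_eq_zero.1 this).resolve_left (hfac α)
      · exact (mem_forms_natCast.1 F.2).coeff_eq_zero hα
    · intro f hf
      ext α
      by_cases hα : α.degree = t
      · have := hf ⟨_, hmon α hα⟩
        rw [hB, apolarPairing_monomial_left] at this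
        exact (mul_eq_zero.1 this).resolve_left (hfac α)
      · exact (mem_forms_natCast.1 f.2).coeff_eq_zero hα
  have h1 := LinearMap.BilinForm.finrank_orthogonal hnd (W.comap (forms n t).subtype)
  have h2 : S = (B.orthogonal (W.comap (forms n t).subtype)).map (forms n t).subtype := by
    ext f
    rw [hS]
    constructor
    · rintro ⟨hf, h⟩
      exact ⟨⟨f, hf⟩, fun F hF => h F hF, rfl⟩
    · rintro ⟨f, h, rfl⟩
      exact ⟨f.2, fun F hF => h ⟨F, hW hF⟩ hF⟩
  have h3 := (Submodule.comapSubtypeEquivOfLe hW).finrank_eq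
  have h4 := Submodule.finrank_mono hW
  rw [h2, Submodule.finrank_map_subtype_eq, h1, h3, Nat.sub_add_cancel h4]

lemma finrank_apolarForms_inf_multiplicityAtLeast {n k t : ℕ}
    (I : Ideal (MvPolynomial (Fin (n + 1)) ℂ)) {s : ℤ} (hs : s + k = t) (a : Fin (n + 1) → ℂ) :
    Module.finrank ℂ ↥(apolarForms I t ⊓ multiplicityAtLeast (s + 1) a) + powMulRank I k s a =
      Module.finrank ℂ (quotPiece I t) := by
  have h1 := finrank_apolarPairing_orthogonal (n := n) (t := t)
    (W := powMulForms k s a ⊔ idealPiece I t)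
    (S := apolarForms I t ⊓ multiplicityAtLeast (s + 1) a)
    (sup_le (hs ▸ powMulForms_le k s a) inf_le_right) (fun f => by
      rw [Submodule.mem_inf, mem_apolarForms_iff, and_assoc]
      refine and_congr_right fun hf => ?_
      rw [mem_multiplicityAtLeast_iff hs a hf]
      constructor
      · rintro ⟨hI, hL⟩ F hF
        obtain ⟨P, hP, Q, hQ, rfl⟩ := Submodule.mem_sup.1 hF
        rw [map_add, LinearMap.add_apply, hI Q hQ, hL P hP, add_zero]
      · exact fun h => ⟨fun F hF => h F (Submodule.mem_sup_right hF),
          fun P hP => h P (Submodule.mem_sup_left hP)⟩)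
  have h2 := Submodule.finrank_sup_add_finrank_inf_eq (powMulForms k s a) (idealPiece I t)
  have h3 := powMulRank_add_finrank_inf I k s a
  rw [hs] at h3
  have h4 := finrank_quotPiece_add_finrank_idealPiece I t
  omega

/-! ### Osculating spaces of the projected Veronese variety -/

/-- For `e > u` the descending factorial vanishes, so the truncated exponent `u - e` is harmless. -/
lemma pderiv_pow_linear_pow {A : Type*} [CommRing A] {m : ℕ} {φ : MvPolynomial (Fin m) A}
    {j : Fin m} {b : A} (hφ : pderiv j φ = C b) (c : A) (u e : ℕ) :
    (((pderiv j).toLinearMap : Module.End A (MvPolynomial (Fin m) A)) ^ e) (C c * φ ^ u) =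
      C (b ^ e * c * u.descFactorial e) * φ ^ (u - e) := by
  induction e with
  | zero => simp
  | succ e ih =>
    rw [pow_succ', Module.End.mul_apply, ih]
    change pderiv j _ = _
    rw [pderiv_C_mul, pderiv_pow, hφ, Nat.descFactorial_succ, Nat.sub_sub, ← map_natCast C]
    push_cast
    simp only [C_mul, C_pow]
    ring

lemma partialDeriv_linear_pow {A : Type*} [CommRing A] {m : ℕ} {φ : MvPolynomial (Fin m) A}
    {b : Fin m → A} (hφ : ∀ j, pderiv j φ = C (b j)) (t : ℕ) (α : Fin m →₀ ℕ) :
    partialDeriv α (φ ^ t) =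
      C ((∏ j, b j ^ α j) * t.descFactorial α.degree) * φ ^ (t - α.degree) := by
  rw [degree_eq_sum_finRange, Fin.prod_univ_def, partialDeriv]
  induction List.finRange m with
  | nil => simp
  | cons j l ih =>
    rw [List.map_cons, List.prod_cons, Module.End.mul_apply, ih, pderiv_pow_linear_pow (hφ j),
      List.map_cons, List.map_cons, List.prod_cons, List.sum_cons, Nat.sub_sub,
      Nat.add_comm (α j)]
    congr 2
    rw [← Nat.descFactorial_mul_descFactorial (Nat.le_add_right (l.map α).sum (α j)),
      Nat.add_sub_cancel_left]
    push_cast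
    ring

lemma linForm_cons_one {n : ℕ} (y : Fin n → ℂ) :
    linForm (Fin.cons 1 y : Fin (n + 1) → ℂ) = X 0 + ∑ j : Fin n, C (y j) * X j.succ := by
  simp [linForm, Fin.sum_univ_succ]

lemma eval_partialDeriv_projVeroneseParam {n : ℕ} (I : Ideal (MvPolynomial (Fin (n + 1)) ℂ))
    (t : ℕ) (α : Fin n →₀ ℕ) (y : Fin n → ℂ) :
    eval (fun j => algebraMap ℂ (MvPolynomial (Fin (n + 1)) ℂ ⧸ I) (y j))
      (partialDeriv α (projVeroneseParam I t)) =
    (t.descFactorial α.degree : ℂ) • Ideal.Quotient.mkₐ ℂ I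
      (linForm (Fin.cons 1 y) ^ (t - α.degree) * ∏ j : Fin n, X j.succ ^ α j) := by
  have hφ : projVeroneseParam I t = (C (Ideal.Quotient.mk I (X 0)) +
      ∑ j : Fin n, C (Ideal.Quotient.mk I (X j.succ)) * X j) ^ t := by
    simp [projVeroneseParam, veroneseParam]
  rw [hφ, partialDeriv_linear_pow (b := fun j => Ideal.Quotient.mk I (X j.succ)) (fun j => by
    simp [pderiv_X, Pi.single_apply]), map_mul, eval_C, map_pow,
    map_add, map_sum, eval_C]
  have hL : Ideal.Quotient.mk I (X 0) + ∑ j : Fin n,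
      eval (fun j => algebraMap ℂ (MvPolynomial (Fin (n + 1)) ℂ ⧸ I) (y j))
        (C (Ideal.Quotient.mk I (X j.succ)) * X j) =
      Ideal.Quotient.mk I (linForm (Fin.cons 1 y)) := by
    rw [linForm_cons_one, map_add, map_sum]
    congr 1
    refine Finset.sum_congr rfl fun j _ => ?_
    rw [map_mul, eval_C, eval_X, map_mul, mul_comm]
    rfl
  rw [hL, Nat.cast_smul_eq_nsmul, nsmul_eq_mul, map_mul, map_pow, map_prod]
  simp only [map_pow, Ideal.Quotient.mkₐ_eq_mk]
  ring

/-- As `x_0` has coefficient `1` in `L`, the forms `L, x_1, …, x_n` are linear coordinates: `f`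
substitutes `x_0 - ∑ y_j x_j` for `x_0`, and `g` undoes it by sending `x_0` to `L`. Applying `g` to
the monomials of `f P` gives the claim. -/
lemma homogeneousSubmodule_le_span_linForm {n : ℕ} (m : ℕ) (y : Fin n → ℂ) :
    homogeneousSubmodule (Fin (n + 1)) ℂ m ≤
      Submodule.span ℂ (Set.range fun α : {α : Fin n →₀ ℕ // α.degree ≤ m} =>
        linForm (Fin.cons 1 y) ^ (m - α.1.degree) * ∏ j : Fin n, X j.succ ^ α.1 j) := by
  let f : MvPolynomial (Fin (n + 1)) ℂ →ₐ[ℂ] MvPolynomial (Fin (n + 1)) ℂ :=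
    aeval (Fin.cons (X 0 - ∑ j : Fin n, C (y j) * X j.succ) fun j : Fin n => X j.succ)
  let g : MvPolynomial (Fin (n + 1)) ℂ →ₐ[ℂ] MvPolynomial (Fin (n + 1)) ℂ :=
    aeval (Fin.cons (linForm (Fin.cons 1 y)) fun j : Fin n => X j.succ)
  have hgf : ∀ P, g (f P) = P := fun P => by
    have : g.comp f = AlgHom.id ℂ _ := by
      ext1 j
      refine Fin.cases ?_ (fun j => ?_) j
      · simp [f, g, linForm_cons_one, ← algebraMap_eq]
      · simp [f, g]
    exact DFunLike.congr_fun this P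
  intro P hP
  have hfP : f P ∈ homogeneousSubmodule (Fin (n + 1)) ℂ m := by
    have := IsHomogeneous.aeval (n := 1) ((mem_homogeneousSubmodule m P).1 hP)
      (Fin.cons (X 0 - ∑ j : Fin n, C (y j) * X j.succ) fun j : Fin n => X j.succ :
        Fin (n + 1) → MvPolynomial (Fin (n + 1)) ℂ) (fun j => by
      refine Fin.cases ?_ (fun j => ?_) j
      · exact (isHomogeneous_X _ _).sub
          (IsHomogeneous.sum _ _ _ fun _ _ => isHomogeneous_C_mul_X _ _)
      · exact isHomogeneous_X _ _)
    rwa [one_mul] at this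
  rw [homogeneousSubmodule_eq_span_monomial] at hfP
  rw [← hgf P]
  have := Submodule.mem_map_of_mem (f := g.toLinearMap) hfP
  rw [Submodule.map_span] at this
  refine Submodule.span_mono ?_ this
  rintro _ ⟨_, ⟨⟨β, hβ⟩, rfl⟩, rfl⟩
  rw [Finsupp.degree_eq_sum, Fin.sum_univ_succ] at hβ
  have hdeg : β.tail.degree = ∑ j : Fin n, β j.succ := by
    simp [Finsupp.degree_eq_sum, Finsupp.tail_apply]
  refine ⟨⟨β.tail, by omega⟩, ?_⟩
  have : m - β.tail.degree = β 0 := by omega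
  change _ = aeval _ (monomial β 1)
  rw [aeval_monomial, Finsupp.prod_fintype _ _ (by simp), Fin.prod_univ_succ]
  simp [this, Finsupp.tail_apply]

/-- The derivative `∂^α` of `L^t` is a scalar times `L^k · (L^{s-|α|} x^α)`, and the bracketed forms
span `R_s`. -/
lemma osculatingSpace_projVeroneseParam {n k t : ℕ} (I : Ideal (MvPolynomial (Fin (n + 1)) ℂ))
    {s : ℤ} (hs : s + k = t) (y : Fin n → ℂ) :
    osculatingSpace (projVeroneseParam I t) s y =
      LinearMap.range (powMulMap I k s (Fin.cons 1 y)) := by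
  rcases lt_or_ge s 0 with hs0 | hs0
  · rw [range_powMulMap, powMulForms, forms_of_neg hs0, Submodule.map_bot, Submodule.map_bot,
      osculatingSpace, Submodule.span_eq_bot]
    rintro _ ⟨α, hα, -⟩
    omega
  lift s to ℕ using hs0
  have hpow : ∀ α : Fin n →₀ ℕ, α.degree ≤ s →
      linForm (Fin.cons 1 y : Fin (n + 1) → ℂ) ^ (t - α.degree) * ∏ j : Fin n, X j.succ ^ α j =
        linForm (Fin.cons 1 y) ^ k *
          (linForm (Fin.cons 1 y) ^ (s - α.degree) * ∏ j : Fin n, X j.succ ^ α j) :=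
    fun α hα => by
      rw [← mul_assoc, ← pow_add, show t - α.degree = k + (s - α.degree) by omega]
  apply le_antisymm
  · refine Submodule.span_le.2 ?_
    rintro _ ⟨α, hα, rfl⟩
    have hα' : α.degree ≤ s := by exact_mod_cast hα
    rw [eval_partialDeriv_projVeroneseParam, hpow α hα']
    refine Submodule.smul_mem _ _ ⟨⟨_, ?_⟩, rfl⟩
    have := (isHomogeneous_linForm_pow (Fin.cons 1 y) (s - α.degree)).mul
      (IsHomogeneous.prod Finset.univ (fun j : Fin n => (X j.succ : MvPolynomial _ ℂ) ^ α j) α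
        fun j _ => isHomogeneous_X_pow _ _)
    rwa [← Finsupp.degree_eq_sum, Nat.sub_add_cancel hα'] at this
  · rw [powMulMap, LinearMap.range_domRestrict, forms_natCast]
    refine (Submodule.map_mono (homogeneousSubmodule_le_span_linForm s y)).trans ?_
    rw [Submodule.map_span, Submodule.span_le]
    rintro _ ⟨_, ⟨⟨α, hα⟩, rfl⟩, rfl⟩
    -- The scalar is nonzero because `|α| ≤ s ≤ t`.
    have hne : (t.descFactorial α.degree : ℂ) ≠ 0 := by
      rw [Nat.cast_ne_zero, Ne, Nat.descFactorial_eq_zero_iff_lt]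
      omega
    rw [SetLike.mem_coe, ← Submodule.smul_mem_iff _ hne]
    refine Submodule.subset_span ⟨α, by exact_mod_cast hα, ?_⟩
    rw [eval_partialDeriv_projVeroneseParam, hpow α hα]
    rfl

/-! ### The conditions in terms of the general rank -/

lemma hasRelations_iff {n r d i k : ℕ} {F : Fin r → MvPolynomial (Fin (n + 1)) ℂ}
    (hF : ∀ j, (F j).IsHomogeneous d) (hsyz : NoSyzygy F i) (c : ℕ) {ρ : ℕ}
    (hρ : ForGeneral fun a : Fin (n + 1) → ℂ =>
      powMulRank (Ideal.span (Set.range F)) k ((d : ℤ) + i - k) a = ρ) :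
    HasRelations F d i k c ↔
      c + ρ ≤ Module.finrank ℂ (quotPiece (Ideal.span (Set.range F)) ((d : ℤ) + i - k)) := by
  constructor
  · intro h
    obtain ⟨a, ⟨hrel, ha⟩, hrank⟩ := exists_of_forGeneral (h.and (forGeneral_ne_zero n)) hρ
    exact hrank ▸ (exists_relations_iff hF hsyz k c ha).1 hrel
  · intro h
    refine ((forGeneral_ne_zero n).and hρ).mono fun a ha => ?_
    exact (exists_relations_iff hF hsyz k c ha.1).2 (ha.2 ▸ h)

/-- A special `L` can only lower the rank, which enlarges the space of singular forms; the bound for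
all `L` is therefore the bound for general `L`. -/
lemma hasSingularForms_iff {n d i k : ℕ} (I : Ideal (MvPolynomial (Fin (n + 1)) ℂ)) (c : ℕ) {ρ : ℕ}
    (hle : ∀ a, powMulRank I k ((d : ℤ) + i - k) a ≤ ρ)
    (hρ : ForGeneral fun a : Fin (n + 1) → ℂ => powMulRank I k ((d : ℤ) + i - k) a = ρ) :
    HasSingularForms I d i k c ↔ c + ρ ≤ Module.finrank ℂ (quotPiece I ((d : ℤ) + i)) := by
  have key : ∀ a : Fin (n + 1) → ℂ, Module.finrank ℂ
      ↥(apolarForms I ((d : ℤ) + i) ⊓ multiplicityAtLeast ((d : ℤ) + i - k + 1) a) +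
        powMulRank I k ((d : ℤ) + i - k) a = Module.finrank ℂ (quotPiece I ((d : ℤ) + i)) :=
    fun a => by
      have := finrank_apolarForms_inf_multiplicityAtLeast (k := k) (t := d + i) I
        (s := (d : ℤ) + i - k) (by push_cast; ring) a
      rwa [Nat.cast_add] at this
  constructor
  · intro h
    obtain ⟨a, ha, hrank⟩ := exists_of_forGeneral (forGeneral_ne_zero n) hρ
    have h1 := h a ha
    have h2 := key a
    omega
  · intro h a _
    have h1 := key a
    have h2 := hle a
    omega

/-- Discounting the trivial relations turns the number of derivatives, `dim R_s`, into `dim A_s`;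
the projective `-1` cancels on both sides. -/
lemma projectionSatisfiesLaplace_iff {n d i k : ℕ} (I : Ideal (MvPolynomial (Fin (n + 1)) ℂ))
    (δ : ℕ) {ρ : ℕ} (hρ : ForGeneral fun y : Fin n → ℂ =>
      powMulRank I k ((d : ℤ) + i - k) (Fin.cons 1 y) = ρ) :
    ProjectionSatisfiesLaplace I d i k δ ↔
      ρ + δ = min (Module.finrank ℂ (quotPiece I ((d : ℤ) + i - k)))
        (Module.finrank ℂ (quotPiece I ((d : ℤ) + i))) := by
  have hosc : ∀ y : Fin n → ℂ, Module.finrank ℂ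
      (osculatingSpace (projVeroneseParam I (d + i)) ((d : ℤ) + i - k) y) =
        powMulRank I k ((d : ℤ) + i - k) (Fin.cons 1 y) := fun y => by
    rw [osculatingSpace_projVeroneseParam (k := k) I (by push_cast; ring), powMulRank]
  have hdim := finrank_quotPiece_add_finrank_idealPiece I ((d : ℤ) + i - k)
  rw [finrank_forms] at hdim
  constructor
  · intro h
    obtain ⟨y, h1, h2⟩ := exists_of_forGeneral h hρ
    rw [hosc, h2] at h1
    omega
  · intro h
    refine hρ.mono fun y hy => ?_
    rw [hosc, hy]
    omega

lemma failsSLPAt_iff {n k : ℕ} {s : ℤ} (I : Ideal (MvPolynomial (Fin (n + 1)) ℂ)) {ρ : ℕ}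
    (hle : ∀ a, powMulRank I k s a ≤ ρ)
    (hρ : ForGeneral fun a : Fin (n + 1) → ℂ => powMulRank I k s a = ρ) :
    FailsSLPAt I k s ↔ ρ < Module.finrank ℂ (quotPiece I s) ∧
      ρ < Module.finrank ℂ (quotPiece I (s + k)) := by
  constructor
  · intro h
    obtain ⟨a, ha, -⟩ := exists_of_forGeneral hρ hρ
    have h1 := h _ (linForm_mem_forms a)
    rw [hasMaximalRank_iff, not_or, ha] at h1
    exact ⟨lt_of_le_of_ne (ha ▸ powMulRank_le_finrank_source I k s a) h1.1,
      lt_of_le_of_ne (ha ▸ powMulRank_le_finrank_target I k s a) h1.2⟩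
  · rintro ⟨h1, h2⟩ L hL
    obtain ⟨a, rfl⟩ := exists_eq_linForm hL
    rw [hasMaximalRank_iff, not_or]
    exact ⟨((hle a).trans_lt h1).ne, ((hle a).trans_lt h2).ne⟩

lemma finrank_idealPiece_of_lt {n r d i k : ℕ} {F : Fin r → MvPolynomial (Fin (n + 1)) ℂ}
    (hF : ∀ j, (F j).IsHomogeneous d) (hsyz : NoSyzygy F i) (hik : i < k) :
    Module.finrank ℂ (idealPiece (Ideal.span (Set.range F)) ((d : ℤ) + i - k)) = 0 := by
  rw [add_sub_assoc, finrank_idealPiece_of_injective hF (injective_combinationMap_sub hsyz k),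
    dimForms, forms_of_neg (by omega), finrank_bot, mul_zero]

theorem theorem5p1 (n r d i k : ℕ) (hk : 1 ≤ k)
    (F : Fin r → MvPolynomial (Fin (n + 1)) ℂ) (hF : ∀ j, (F j).IsHomogeneous d)
    (I : Ideal (MvPolynomial (Fin (n + 1)) ℂ)) (hI : I = Ideal.span (Set.range F))
    (hart : IsArtinianRing (MvPolynomial (Fin (n + 1)) ℂ ⧸ I))
    (hsyz : NoSyzygy F i) :
    List.TFAE
      [FailsSLPAt I k ((d : ℤ) + i - k),
       ∃ δ : ℕ, 1 ≤ δ ∧ HasRelations F d i k (numNPlus n r i k d + δ),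
       ∃ δ : ℕ, 1 ≤ δ ∧ ProjectionSatisfiesLaplace I d i k δ,
       ∃ δ : ℕ, 1 ≤ δ ∧ HasSingularForms I d i k (numNMinus n r i k d + δ)] ∧
    (∀ δ : ℕ, 1 ≤ δ →
      List.TFAE
        [HasRelations F d i k (numNPlus n r i k d + δ),
         ∃ δ' : ℕ, δ ≤ δ' ∧ ProjectionSatisfiesLaplace I d i k δ',
         HasSingularForms I d i k (numNMinus n r i k d + δ)]) ∧
    (i < k → ∀ δ : ℕ,
      (ProjectionSatisfiesLaplace I d i k δ ↔
        SatisfiesLaplace (quotPiece I ((d : ℤ) + i)) (projVeroneseParam I (d + i))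
          ((d : ℤ) + i - k) δ)) := by
  subst hI
  obtain ⟨ρ, hle, hgen, hgen'⟩ :=
    exists_general_powMulRank (Ideal.span (Set.range F)) k ((d : ℤ) + i - k)
  have hN := numN_eq (k := k) hF hsyz
  have hfail := failsSLPAt_iff (Ideal.span (Set.range F)) hle hgen
  rw [sub_add_cancel] at hfail
  have hrel : ∀ δ, HasRelations F d i k (numNPlus n r i k d + δ) ↔
      ρ + δ ≤ min (Module.finrank ℂ (quotPiece (Ideal.span (Set.range F)) ((d : ℤ) + i - k)))
        (Module.finrank ℂ (quotPiece (Ideal.span (Set.range F)) ((d : ℤ) + i))) := fun δ => by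
    rw [hasRelations_iff hF hsyz _ hgen, numNPlus]
    omega
  have hsing : ∀ δ, HasSingularForms (Ideal.span (Set.range F)) d i k (numNMinus n r i k d + δ) ↔
      ρ + δ ≤ min (Module.finrank ℂ (quotPiece (Ideal.span (Set.range F)) ((d : ℤ) + i - k)))
        (Module.finrank ℂ (quotPiece (Ideal.span (Set.range F)) ((d : ℤ) + i))) := fun δ => by
    rw [hasSingularForms_iff _ _ hle hgen, numNMinus]
    omega
  have hlap := fun δ => projectionSatisfiesLaplace_iff (Ideal.span (Set.range F)) δ hgen'
  simp only [hfail, hrel, hsing, hlap, ← lt_min_iff]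
  generalize min (Module.finrank ℂ (quotPiece (Ideal.span (Set.range F)) ((d : ℤ) + i - k)))
    (Module.finrank ℂ (quotPiece (Ideal.span (Set.range F)) ((d : ℤ) + i))) = M at hlap ⊢
  refine ⟨?_, fun δ _ => ?_, fun hik δ => ?_⟩
  · tfae_have 1 → 3 := fun h => ⟨M - ρ, by omega, by omega⟩
    tfae_have 3 → 2 := fun ⟨δ, h, h'⟩ => ⟨δ, h, h'.le⟩
    tfae_have 2 → 4 := id
    tfae_have 4 → 1 := fun ⟨δ, h, h'⟩ => by omega
    tfae_finish
  · tfae_have 1 → 2 := fun h => ⟨M - ρ, by omega, by omega⟩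
    tfae_have 2 → 3 := fun ⟨δ', h, h'⟩ => by omega
    tfae_have 3 → 1 := id
    tfae_finish
  · rw [← hlap, ProjectionSatisfiesLaplace, finrank_idealPiece_of_lt hF hsyz hik, SatisfiesLaplace]
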